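/- Let $n\ge 1$ and $m\ge 2$ be integers and let $\mathcal H$ be a complex Hilbert space. Let $\mathbb F_n^+$ be the free monoid on generators $g_1,\dots,g_n$ with identity $g_0$, and let $|\alpha|$ denote the length of $\alpha\in\mathbb F_n^+$. Let $F^2(H_n)$ be the full Fock space, with orthonormal basis $\{e_\alpha\}_{\alpha\in\mathbb F_n^+}$, let $S_1,\dots,S_n$ be the left creation operators, $S_ie_\alpha=e_{g_i\alpha}$, and put $S_\alpha=S_{i_1}\cdots S_{i_k}$ for $\alpha=g_{i_1}\cdots g_{i_k}$. For bounded operators $\mathcal A=\{A_{(\alpha)}\}_{|\alpha|\le m-1}$ on $\mathcal H$, with $A_{(0)}:=A_{(g_0)}$ selfadjoint, let $$H_{\mathcal A}(S_1,\dots,S_n)=\operatorname{Re}\Big(\tfrac12 I\otimes A_{(0)}+\sum_{1\le|\alpha|\le m-1}S_\alpha\otimes A_{(\alpha)}\Big),\qquad \operatorname{Re}T=\tfrac12(T+T^*),$$ acting on the Hilbert space tensor product $F^2(H_n)\otimes\mathcal H$. For bounded operators $X_1,\dots,X_N$ on $\mathcal H$, let $w(X_1,\dots,X_N)=\omega(S_1\otimes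 X_1^*+\cdots+S_N\otimes X_N^*)$ be the joint numerical radius, where $S_1,\dots,S_N$ are here the left creation operators on $F^2(H_N)$ and $\omega(T)=\sup\{|\langle Th,h\rangle|:\|h\|=1\}$. Write $[x]$ for the integer part of $x$. The equation $$\sum_{k=1}^{m-1}t^k\cos\frac{\pi}{\left[\frac{m-1}{k}\right]+2}=\frac12$$ has exactly one solution $t=t_m$ in $(0,1]$. Let $\mathcal A=\{A_{(\alpha)}\}_{|\alpha|\le m-1}$ and $\mathcal B=\{B_{(\alpha)}\}_{|\alpha|\le m-1}$ be families of bounded operators on $\mathcal H$ such that $A_{(0)}=A_{(0)}^*$, $B_{(0)}=B_{(0)}^*$ and $$H_{\mathcal A}(S_1,\dots,S_n)\le H_{\mathcal B}(S_1,\dots,S_n).$$ Then $$w\big(B_{(\alpha)}^*-A_{(\alpha)}^*:\ |\alpha|=k\big)\le\|B_{(0)}-A_{(0)}\|\cos\frac{\pi}{\left[\frac{m-1}{k}\right]+2}\qquad\text{for }1\le k\le m-1,$$ and $$\sum_{k=1}^{m-1}r^k\,w\big(A_{(\alpha)}^*:\ |\alpha|=k\big)\le\frac12\|B_{(0)}-A_{(0)}\|+\sum_{k=1}^{m-1}r^k\,w\big(B_{(\alpha)}^*:\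 |\alpha|=k\big)\qquad\text{for }r\in[0,t_m].$$ -/

import Mathlib

open scoped TensorProduct

noncomputable section

namespace NCHarmonic

/-! ### The full Fock space and the left creation operators

The words over an alphabet `ι` form the free monoid `FreeMonoid ι`, the empty word being `1`. -/

/-- The full Fock space over a Hilbert space with orthonormal basis indexed by `ι`:
the Hilbert space whose orthonormal basis consists of the vectors `e_α`,
one for each word `α = g_{i₁} ⋯ g_{iₖ}` (with `e_α = e_{i₁} ⊗ ⋯ ⊗ e_{iₖ}`). -/
abbrev Fock (ι : Type*) : Type _ := lp (fun _ : FreeMonoid ι => ℂ) 2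

open Classical in
/-- The basis vector `e_α`. -/
def fockBasis {ι : Type*} (α : FreeMonoid ι) : Fock ι := lp.single 2 α (1 : ℂ)

theorem fockBasis_orthonormal (ι : Type*) :
    Orthonormal ℂ (fun α : FreeMonoid ι => (fockBasis α : Fock ι)) := by
  classical
  rw [orthonormal_iff_ite]
  intro α β
  rw [fockBasis, fockBasis, lp.inner_single_left, lp.single_apply]
  by_cases h : α = β
  · subst h; simp
  · simp [h]

theorem shifted_orthonormal {ι : Type*} (i : ι) :
    Orthonormal ℂ (fun α : FreeMonoid ι => (fockBasis (FreeMonoid.of i * α) : Fock ι)) :=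
  (fockBasis_orthonormal ι).comp _ (mul_right_injective _)

/-- The left creation operator `S_i φ = e_i ⊗ φ`, that is, the isometry with
`S_i e_α = e_{g_i α}`. -/
def creation {ι : Type*} (i : ι) : Fock ι →L[ℂ] Fock ι :=
  (shifted_orthonormal i).orthogonalFamily.linearIsometry.toContinuousLinearMap

theorem creation_fockBasis {ι : Type*} (i : ι) (α : FreeMonoid ι) :
    creation i (fockBasis α) = fockBasis (FreeMonoid.of i * α) := by
  classical
  have h := (shifted_orthonormal i).orthogonalFamily.linearIsometry_apply_single (i := α) (1 : ℂ)
  rw [LinearIsometry.toSpanSingleton_apply, one_smul] at h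
  rw [creation, ← h, fockBasis]
  simp only [LinearIsometry.coe_toContinuousLinearMap]

/-- The product `T_α = T_{i₁} ⋯ T_{iₖ}` for `α = g_{i₁} ⋯ g_{iₖ}`, with `T_1 = I`. -/
def wordProd {ι E : Type*} [NormedAddCommGroup E] [InnerProductSpace ℂ E]
    (T : ι → E →L[ℂ] E) (α : FreeMonoid ι) : E →L[ℂ] E :=
  FreeMonoid.lift T α

/-- The words of length `k`. -/
abbrev Words (ι : Type*) (k : ℕ) : Type _ := {α : FreeMonoid ι // α.length = k}

instance {ι : Type*} [Fintype ι] (k : ℕ) : Fintype (Words ι k) :=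
  inferInstanceAs (Fintype (List.Vector ι k))

/-! ### Hilbert space tensor products -/

/-- The Hilbert space tensor product: the completion of the algebraic tensor product with
respect to the inner product `⟪x ⊗ y, x' ⊗ y'⟫ = ⟪x, x'⟫ * ⟪y, y'⟫`. -/
abbrev HTensor (E H : Type*) [NormedAddCommGroup E] [InnerProductSpace ℂ E]
    [NormedAddCommGroup H] [InnerProductSpace ℂ H] : Type _ :=
  UniformSpace.Completion (E ⊗[ℂ] H)

/-- The bounded operator `T ⊗ A` with `(T ⊗ A) (x ⊗ y) = T x ⊗ A y`. -/
def opTensor {E H : Type*} [NormedAddCommGroup E] [InnerProductSpace ℂ E]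
    [NormedAddCommGroup H] [InnerProductSpace ℂ H] (T : E →L[ℂ] E) (A : H →L[ℂ] H) :
    HTensor E H →L[ℂ] HTensor E H :=
  (TensorProduct.mapL T A).completion

theorem opTensor_tmul {E H : Type*} [NormedAddCommGroup E] [InnerProductSpace ℂ E]
    [NormedAddCommGroup H] [InnerProductSpace ℂ H] (T : E →L[ℂ] E) (A : H →L[ℂ] H)
    (x : E) (y : H) :
    opTensor T A ((x ⊗ₜ[ℂ] y : E ⊗[ℂ] H) : HTensor E H) = ((T x ⊗ₜ[ℂ] A y : E ⊗[ℂ] H) :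
      HTensor E H) := by
  simp [opTensor]

/-! ### Numerical radii -/

/-- The numerical radius `ω(T) = sup {|⟪T h, h⟫| : ‖h‖ = 1}`. -/
def numericalRadius {E : Type*} [NormedAddCommGroup E] [InnerProductSpace ℂ E]
    (T : E →L[ℂ] E) : ℝ :=
  sSup {c : ℝ | ∃ h : E, ‖h‖ = 1 ∧ c = ‖inner ℂ (T h) h‖}

theorem numericalRadius_bddAbove {E : Type*} [NormedAddCommGroup E] [InnerProductSpace ℂ E]
    (T : E →L[ℂ] E) : BddAbove {c : ℝ | ∃ h : E, ‖h‖ = 1 ∧ c = ‖inner ℂ (T h) h‖} := by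
  refine ⟨‖T‖, ?_⟩
  rintro c ⟨h, hh, rfl⟩
  have h1 := norm_inner_le_norm (𝕜 := ℂ) (T h) h
  have h2 := T.le_opNorm h
  rw [hh, mul_one] at h1 h2
  exact h1.trans h2

/-- The joint numerical radius `w(X_i : i ∈ ι) = ω(∑ i, S_i ⊗ X_i^*)` of a finite family of
bounded operators, where the `S_i` are the left creation operators on the full Fock space with
one generator for each member of the family. -/
def jointNumericalRadius {ι H : Type*} [Fintype ι] [NormedAddCommGroup H]
    [InnerProductSpace ℂ H] [CompleteSpace H] (X : ι → H →L[ℂ] H) : ℝ :=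
  numericalRadius (∑ i, opTensor (creation i) (ContinuousLinearMap.adjoint (X i)) :
    HTensor (Fock ι) H →L[ℂ] HTensor (Fock ι) H)

/-! ### Selfadjoint harmonic polynomials -/

/-- The polynomial `F(S_1, …, S_n) = (1/2) I ⊗ A_0 + ∑_{1 ≤ |α| ≤ m - 1} S_α ⊗ A_α`.
Only the coefficients with `|α| ≤ m - 1` matter. -/
def analyticPoly {n : ℕ} {H : Type*} [NormedAddCommGroup H] [InnerProductSpace ℂ H]
    (m : ℕ) (A : FreeMonoid (Fin n) → H →L[ℂ] H) :
    HTensor (Fock (Fin n)) H →L[ℂ] HTensor (Fock (Fin n)) H :=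
  (1 / 2 : ℂ) • opTensor (ContinuousLinearMap.id ℂ (Fock (Fin n))) (A 1) +
    ∑ k ∈ Finset.Icc 1 (m - 1), ∑ α : Words (Fin n) k,
      opTensor (wordProd creation (α : FreeMonoid (Fin n))) (A α)

/-- The selfadjoint harmonic polynomial `H_A(S_1, …, S_n) = Re F(S_1, …, S_n)`, where
`Re T = (T + T^*) / 2`. -/
def harmonicPoly {n : ℕ} {H : Type*} [NormedAddCommGroup H] [InnerProductSpace ℂ H]
    (m : ℕ) (A : FreeMonoid (Fin n) → H →L[ℂ] H) :
    HTensor (Fock (Fin n)) H →L[ℂ] HTensor (Fock (Fin n)) H :=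
  (1 / 2 : ℂ) • (analyticPoly m A + ContinuousLinearMap.adjoint (analyticPoly m A))

/-! ### The radius `t_m` -/

/-- The number `cos (π / ([(m - 1) / k] + 2))`, where `[x]` is the integer part of `x`
(the quotient is the integer division of natural numbers). -/
def fejerConst (m k : ℕ) : ℝ := Real.cos (Real.pi / ((((m - 1) / k : ℕ) : ℝ) + 2))

/-- `t` lies in `(0, 1]` and solves
`∑_{k=1}^{m-1} t^k cos (π / ([(m - 1) / k] + 2)) = 1 / 2`. -/
def IsBohrRadius (m : ℕ) (t : ℝ) : Prop :=
  t ∈ Set.Ioc (0 : ℝ) 1 ∧ ∑ k ∈ Finset.Icc 1 (m - 1), t ^ k * fejerConst m k = 1 / 2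

end NCHarmonic

end

open scoped TensorProduct

noncomputable section

namespace NCHarmonic

/-! Put `C = B - A`. The hypothesis says that `Re ⟪x, F x⟫ ≥ 0` for every `x`, where `F` is the
analytic polynomial of `C`. For `|z| = 1` the gauge isometry `e_α ↦ conj z ^ |α| e_α` multiplies the
degree `p` part of this form by `z ^ p`. Each vector `y` thus gives a nonnegative trigonometric
polynomial of degree at most `m - 1`, whose `k`-th coefficient is `∑_{|α| = k} ⟪y, (S_α ⊗ C_α) y⟫`.
Fejér's inequality (`norm_coeff_le_of_trigPoly_nonneg`) bounds it by `cos (π / ([(m - 1) / k] + 2))`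
times the constant term, which is at most `‖C_1‖` for a unit vector `y`.

The joint numerical radius lives on the Fock space over the alphabet of words of length `k`.
Concatenation embeds that space isometrically in the original one (`regroup`) and intertwines its
creation operators with the `S_α`, so it is enough to take `y` in the image. The Bohr type
inequality then follows from the triangle inequality, summation, and the equation defining `t_m`. -/

/-! ### Fejér's coefficient inequality -/

theorem cos_odd_mul_pi_div_le {q : ℕ} (hq : 1 ≤ q) (j : ℕ) :
    Real.cos ((2 * j + 1) * Real.pi / q) ≤ Real.cos (Real.pi / q) := by
  have hq0 : (0 : ℝ) < q := by exact_mod_cast hq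
  have hpi := Real.pi_pos
  -- By periodicity `j` may be reduced modulo `q`; the angle then lies in `[π / q, 2π - π / q]`.
  have hmod : Real.cos ((2 * j + 1) * Real.pi / q) =
      Real.cos ((2 * (j % q : ℕ) + 1) * Real.pi / q) := by
    have h : (j : ℝ) = q * (j / q : ℕ) + (j % q : ℕ) := by exact_mod_cast (Nat.div_add_mod j q).symm
    rw [← Real.cos_add_nat_mul_two_pi ((2 * (j % q : ℕ) + 1) * Real.pi / q) (j / q)]
    congr 1
    rw [h]
    field_simp
    ring
  rw [hmod]
  have hlt : j % q < q := Nat.mod_lt _ hq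
  generalize j % q = i at hlt
  have hi : (i : ℝ) + 1 ≤ q := by exact_mod_cast hlt
  have hi0 : (0 : ℝ) ≤ i := i.cast_nonneg
  have hle : Real.pi / q ≤ (2 * i + 1) * Real.pi / q := by
    gcongr
    nlinarith
  have hle' : (2 * i + 1) * Real.pi / q ≤ 2 * Real.pi - Real.pi / q := by
    rw [div_le_iff₀ hq0, sub_mul, div_mul_cancel₀ _ hq0.ne']
    nlinarith
  have hpos : 0 ≤ Real.pi / q := by positivity
  rcases le_total ((2 * i + 1) * Real.pi / q) Real.pi with h | h
  · exact Real.cos_le_cos_of_nonneg_of_le_pi hpos h hle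
  · rw [← Real.cos_two_pi_sub]
    exact Real.cos_le_cos_of_nonneg_of_le_pi hpos (by linarith) (by linarith)

/-- The `j`-th root of `z ^ L = -1`. -/
def negOneRoot (L j : ℕ) : ℂ := Complex.exp (((2 * j + 1) * Real.pi / L : ℝ) * Complex.I)

theorem norm_negOneRoot (L j : ℕ) : ‖negOneRoot L j‖ = 1 :=
  Complex.norm_exp_ofReal_mul_I _

theorem re_negOneRoot_pow (k q j : ℕ) (hk : 1 ≤ k) :
    (negOneRoot (k * q) j ^ k).re = Real.cos ((2 * j + 1) * Real.pi / q) := by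
  have hk0 : (k : ℝ) ≠ 0 := by positivity
  rw [negOneRoot, ← Complex.exp_nat_mul, ← Complex.exp_ofReal_mul_I_re]
  congr 2
  rw [← mul_assoc]
  congr 1
  rw [← Complex.ofReal_natCast, ← Complex.ofReal_mul, Nat.cast_mul]
  congr 1
  rw [mul_div_assoc', mul_div_mul_left _ _ hk0]

/-- The roots form a geometric progression whose ratio is a primitive `L`-th root of unity. Integer
exponents are needed because differences `p - k` occur below. -/
theorem sum_negOneRoot_zpow {L : ℕ} (hL : L ≠ 0) {p : ℤ} (hp : ¬ (L : ℤ) ∣ p) :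
    ∑ j ∈ Finset.range L, negOneRoot L j ^ p = 0 := by
  have hζ := Complex.isPrimitiveRoot_exp L hL
  set ζ := Complex.exp (2 * Real.pi * Complex.I / L) with hζdef
  have hj : ∀ j, negOneRoot L j = negOneRoot L 0 * ζ ^ j := by
    intro j
    rw [negOneRoot, negOneRoot, hζdef, ← Complex.exp_nat_mul, ← Complex.exp_add]
    congr 1
    push_cast
    ring
  have hne : ζ ^ p ≠ 1 := fun h => hp ((hζ.zpow_eq_one_iff_dvd p).1 h)
  have hgeom : ∑ j ∈ Finset.range L, (ζ ^ p) ^ j = 0 := by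
    have h := mul_neg_geom_sum (ζ ^ p) L
    have h1 : (ζ ^ p) ^ L = 1 := by
      rw [← zpow_natCast, ← zpow_mul, mul_comm, zpow_mul, zpow_natCast, hζ.pow_eq_one, one_zpow]
    rw [h1, sub_self] at h
    exact (mul_eq_zero.1 h).resolve_left (sub_ne_zero.2 hne.symm)
  calc ∑ j ∈ Finset.range L, negOneRoot L j ^ p
      = ∑ j ∈ Finset.range L, negOneRoot L 0 ^ p * (ζ ^ p) ^ j := by
        refine Finset.sum_congr rfl fun j _ => ?_
        rw [hj j, mul_zpow, ← zpow_natCast ζ, ← zpow_mul, mul_comm (j : ℤ), zpow_mul, zpow_natCast]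
    _ = 0 := by rw [← Finset.mul_sum, hgeom, mul_zero]

/-- Writing `Re z ^ k = (z ^ k + z ^ (-k)) / 2` leaves the exponents `p ± k`, of absolute value less
than `L`; only `p - k = 0` survives summation. -/
theorem sum_negOneRoot_pow_mul_re {L k p : ℕ} (hk : 1 ≤ k) (hp : 1 ≤ p) (h : p + k < L) :
    ∑ j ∈ Finset.range L, negOneRoot L j ^ p * ((negOneRoot L j ^ k).re : ℂ) =
      if p = k then (L : ℂ) / 2 else 0 := by
  have hL : L ≠ 0 := by omega
  have hterm : ∀ j, negOneRoot L j ^ p * ((negOneRoot L j ^ k).re : ℂ) =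
      (negOneRoot L j ^ ((p : ℤ) + k) + negOneRoot L j ^ ((p : ℤ) - k)) / 2 := by
    intro j
    have hz : negOneRoot L j ≠ 0 := by
      rw [← norm_ne_zero_iff, norm_negOneRoot]; exact one_ne_zero
    have hconj : (starRingEnd ℂ) (negOneRoot L j ^ k) = (negOneRoot L j ^ k)⁻¹ := by
      rw [Complex.inv_eq_conj]
      rw [norm_pow, norm_negOneRoot, one_pow]
    rw [Complex.re_eq_add_conj, hconj, zpow_add₀ hz, zpow_sub₀ hz]
    simp only [zpow_natCast]
    ring
  simp_rw [hterm]
  rw [← Finset.sum_div, Finset.sum_add_distrib,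
    sum_negOneRoot_zpow hL (p := (p : ℤ) + k)
      (fun hd => by have := Int.le_of_dvd (by omega) hd; omega)]
  split_ifs with hpk
  · simp [hpk]
  · rw [sum_negOneRoot_zpow hL (fun hd => by
      rcases lt_or_gt_of_ne hpk with h' | h'
      · have := Int.le_of_dvd (by omega) ((dvd_neg).2 hd); omega
      · have := Int.le_of_dvd (by omega) hd; omega)]
    simp

theorem fejerConst_nonneg (m k : ℕ) : 0 ≤ fejerConst m k := by
  unfold fejerConst
  have h : (0 : ℝ) ≤ ((m - 1) / k : ℕ) := Nat.cast_nonneg _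
  have hpi := Real.pi_pos
  refine Real.cos_nonneg_of_mem_Icc ⟨?_, ?_⟩
  · have : 0 ≤ Real.pi / ((((m - 1) / k : ℕ) : ℝ) + 2) := by positivity
    linarith
  · gcongr
    linarith

theorem half_le_fejerConst {m k : ℕ} (hk : 1 ≤ k) (hkm : k ≤ m - 1) : 1 / 2 ≤ fejerConst m k := by
  unfold fejerConst
  have h : (1 : ℝ) ≤ ((m - 1) / k : ℕ) := by exact_mod_cast (Nat.one_le_div_iff hk).2 hkm
  have hpi := Real.pi_pos
  rw [← Real.cos_pi_div_three]
  refine Real.cos_le_cos_of_nonneg_of_le_pi (by positivity) (by linarith) ?_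
  gcongr
  linarith

/-- Fejér's coefficient estimate for nonnegative trigonometric polynomials, real part version. -/
theorem re_coeff_le_of_trigPoly_nonneg {m k : ℕ} (hk : 1 ≤ k) (hkm : k ≤ m - 1) (a : ℝ) (f : ℕ → ℂ)
    (hpos : ∀ z : ℂ, ‖z‖ = 1 → 0 ≤ a + (∑ p ∈ Finset.Icc 1 (m - 1), z ^ p * f p).re) :
    (f k).re ≤ 2 * a * fejerConst m k := by
  -- The average runs over the roots of `z ^ L = -1`, `L = k * q`. This `q` makes `L > (m - 1) + k`,
  -- so no aliasing occurs.
  set q := (m - 1) / k + 2 with hq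
  have hq2 : 2 ≤ q := Nat.le_add_left 2 _
  set L := k * q with hLdef
  have hbound : ∀ p ∈ Finset.Icc 1 (m - 1), p + k < L := by
    intro p hp
    have h1 := Nat.lt_mul_div_succ (m - 1) (b := k) (by omega)
    have h2 := (Finset.mem_Icc.1 hp).2
    have h3 : L = k * ((m - 1) / k + 1) + k := by rw [hLdef, hq]; ring
    omega
  have hL : 0 < L := Nat.mul_pos hk (by linarith)
  have hL0 : (0 : ℝ) < L := by exact_mod_cast hL
  set c := fejerConst m k with hc
  have hcq : c = Real.cos (Real.pi / q) := by rw [hc, fejerConst, hq]; push_cast; rfl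
  -- The weight is nonnegative because `z ^ k` is a `q`-th root of `-1`, with real part at most `cos
  -- (π / q)`. It isolates the constant term and the `k`-th coefficient.
  let w : ℕ → ℝ := fun j => c - (negOneRoot L j ^ k).re
  have hw : ∀ j, 0 ≤ w j := by
    intro j
    have := cos_odd_mul_pi_div_le (q := q) (by linarith) j
    simp only [w]
    rw [hcq, hLdef, re_negOneRoot_pow k q j hk]
    linarith
  have hsum : 0 ≤ ∑ j ∈ Finset.range L, w j *
      (a + (∑ p ∈ Finset.Icc 1 (m - 1), negOneRoot L j ^ p * f p).re) :=
    Finset.sum_nonneg fun j _ => mul_nonneg (hw j) (hpos _ (norm_negOneRoot L j))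
  have hz : ∀ p ∈ Finset.Icc 1 (m - 1), ∑ j ∈ Finset.range L, negOneRoot L j ^ p = 0 := by
    intro p hp
    have h1 := hbound p hp
    have h2 := (Finset.mem_Icc.1 hp).1
    have := sum_negOneRoot_zpow hL.ne' (p := p) (fun hd => by
      have := Int.le_of_dvd (by omega) hd; omega)
    simpa only [zpow_natCast] using this
  have hw1 : ∑ j ∈ Finset.range L, w j = L * c := by
    have h : ∑ j ∈ Finset.range L, (negOneRoot L j ^ k).re = 0 := by
      rw [← Complex.re_sum, hz k (Finset.mem_Icc.2 ⟨hk, hkm⟩), Complex.zero_re]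
    simp [w, Finset.sum_sub_distrib, h]
  have hw2 : ∀ p ∈ Finset.Icc 1 (m - 1), ∑ j ∈ Finset.range L, (w j : ℂ) * negOneRoot L j ^ p =
      if p = k then -((L : ℂ) / 2) else 0 := by
    intro p hp
    have h := sum_negOneRoot_pow_mul_re hk (Finset.mem_Icc.1 hp).1 (hbound p hp)
    have : ∀ j, (w j : ℂ) * negOneRoot L j ^ p = c * negOneRoot L j ^ p -
        negOneRoot L j ^ p * ((negOneRoot L j ^ k).re : ℂ) := by
      intro j; simp only [w]; push_cast; ring
    simp_rw [this]
    rw [Finset.sum_sub_distrib, ← Finset.mul_sum, hz p hp, h]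
    split_ifs <;> simp
  have hw3 : ∑ j ∈ Finset.range L, w j * (∑ p ∈ Finset.Icc 1 (m - 1), negOneRoot L j ^ p * f p).re
      = -(L / 2) * (f k).re := by
    have h1 : ∀ j, w j * (∑ p ∈ Finset.Icc 1 (m - 1), negOneRoot L j ^ p * f p).re =
        (∑ p ∈ Finset.Icc 1 (m - 1), ((w j : ℂ) * negOneRoot L j ^ p) * f p).re := by
      intro j
      rw [← Complex.re_ofReal_mul, Finset.mul_sum]
      simp_rw [mul_assoc]
    simp_rw [h1]
    rw [← Complex.re_sum, Finset.sum_comm]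
    simp_rw [← Finset.sum_mul]
    rw [Finset.sum_congr rfl fun p hp => by rw [hw2 p hp]]
    simp only [ite_mul, zero_mul, Finset.sum_ite_eq', Finset.mem_Icc, hk, hkm, and_self, if_true]
    rw [← Complex.re_ofReal_mul]
    push_cast
    ring_nf
  simp_rw [mul_add] at hsum
  rw [Finset.sum_add_distrib, ← Finset.sum_mul, hw1, hw3] at hsum
  have : 0 ≤ L * (c * a - (f k).re / 2) := by linarith
  have := nonneg_of_mul_nonneg_right this hL0
  linarith

/-- Fejér's coefficient estimate for nonnegative trigonometric polynomials. -/
theorem norm_coeff_le_of_trigPoly_nonneg {m k : ℕ} (hk : 1 ≤ k) (hkm : k ≤ m - 1) (a : ℝ)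
    (f : ℕ → ℂ)
    (hpos : ∀ z : ℂ, ‖z‖ = 1 → 0 ≤ a + (∑ p ∈ Finset.Icc 1 (m - 1), z ^ p * f p).re) :
    ‖f k‖ ≤ 2 * a * fejerConst m k := by
  -- Rotating the variable by `μ` makes the `k`-th coefficient equal to its modulus, which reduces
  -- the claim to real parts.
  set μ : ℂ := Complex.exp ((-(Complex.arg (f k) / k) : ℝ) * Complex.I) with hμdef
  have hμ : ‖μ‖ = 1 := Complex.norm_exp_ofReal_mul_I _
  have hk0 : (k : ℂ) ≠ 0 := by exact_mod_cast (by omega : k ≠ 0)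
  have hμk : μ ^ k * f k = ‖f k‖ := by
    conv_lhs => rw [← Complex.norm_mul_exp_arg_mul_I (f k)]
    rw [hμdef, ← Complex.exp_nat_mul, mul_left_comm, ← Complex.exp_add]
    rw [show (k : ℂ) * (((-(Complex.arg (f k) / k) : ℝ) : ℂ) * Complex.I) +
      (Complex.arg (f k) : ℂ) * Complex.I = 0 by push_cast; field_simp; ring]
    simp
  have h := re_coeff_le_of_trigPoly_nonneg hk hkm a (fun p => μ ^ p * f p) (fun z hz => by
    have := hpos (z * μ) (by rw [norm_mul, hz, hμ, one_mul])
    simpa only [mul_pow, mul_assoc] using this)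
  simpa only [hμk, Complex.ofReal_re] using h

/-! ### The radius `t_m` -/

/-- The left side is continuous and strictly increasing on `[0, ∞)`, vanishes at `0`, and at `1` is
at least its `k = 1` term, hence at least `1 / 2`. -/
theorem existsUnique_isBohrRadius {m : ℕ} (hm : 2 ≤ m) : ∃! t : ℝ, IsBohrRadius m t := by
  let g : ℝ → ℝ := fun t => ∑ k ∈ Finset.Icc 1 (m - 1), t ^ k * fejerConst m k
  have hmono : StrictMonoOn g (Set.Ici 0) := by
    intro s hs t _ hst
    refine Finset.sum_lt_sum (fun k _ => ?_) ⟨1, Finset.mem_Icc.2 ⟨le_rfl, by omega⟩, ?_⟩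
    · exact mul_le_mul_of_nonneg_right (pow_le_pow_left₀ hs hst.le k) (fejerConst_nonneg m k)
    · have := half_le_fejerConst (m := m) le_rfl (by omega : 1 ≤ m - 1)
      rw [pow_one, pow_one]
      exact mul_lt_mul_of_pos_right hst (by linarith)
  have hcont : ContinuousOn g (Set.Icc 0 1) := by
    refine Continuous.continuousOn ?_
    fun_prop
  have h0 : g 0 = 0 := Finset.sum_eq_zero fun k hk => by
    rw [zero_pow (by have := (Finset.mem_Icc.1 hk).1; omega), zero_mul]
  have h1 : 1 / 2 ≤ g 1 := by
    have hmem : 1 ∈ Finset.Icc 1 (m - 1) := Finset.mem_Icc.2 ⟨le_rfl, by omega⟩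
    have := Finset.single_le_sum (f := fun k => (1 : ℝ) ^ k * fejerConst m k)
      (fun k _ => by simpa using fejerConst_nonneg m k) hmem
    have h2 := half_le_fejerConst (m := m) le_rfl (by omega : 1 ≤ m - 1)
    simp only [one_pow, one_mul] at this
    simp only [g, one_pow, one_mul]
    linarith
  obtain ⟨t, ht, hgt⟩ := intermediate_value_Icc zero_le_one hcont
    (⟨by rw [h0]; norm_num, h1⟩ : (1 / 2 : ℝ) ∈ Set.Icc (g 0) (g 1))
  have htpos : 0 < t := by
    rcases ht.1.lt_or_eq with h | h
    · exact h
    · rw [← h, h0] at hgt; norm_num at hgt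
  refine ⟨t, ⟨⟨htpos, ht.2⟩, hgt⟩, fun s hs => ?_⟩
  exact hmono.injOn (Set.mem_Ici.2 hs.1.1.le) (Set.mem_Ici.2 htpos.le) (hs.2.trans hgt.symm)


/-! ### Gauge and regrouping isometries of the Fock space -/

theorem fock_ext {ι F : Type*} [NormedAddCommGroup F] [InnerProductSpace ℂ F]
    {f g : Fock ι →L[ℂ] F} (h : ∀ α, f (fockBasis α) = g (fockBasis α)) : f = g := by
  classical
  refine lp.ext_continuousLinearMap (by norm_num) fun α => ?_
  ext
  have := h α
  rw [fockBasis] at this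
  convert! this

/-- The isometry of the Fock space that maps the basis `e_α` to a given orthonormal family. -/
def fockLift {ι E : Type*} [NormedAddCommGroup E] [InnerProductSpace ℂ E] [CompleteSpace E]
    {v : FreeMonoid ι → E} (hv : Orthonormal ℂ v) : Fock ι →ₗᵢ[ℂ] E :=
  hv.orthogonalFamily.linearIsometry

theorem fockLift_fockBasis {ι E : Type*} [NormedAddCommGroup E] [InnerProductSpace ℂ E]
    [CompleteSpace E] {v : FreeMonoid ι → E} (hv : Orthonormal ℂ v) (α : FreeMonoid ι) :
    fockLift hv (fockBasis α) = v α := by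
  classical
  have h := hv.orthogonalFamily.linearIsometry_apply_single (i := α) (1 : ℂ)
  rw [LinearIsometry.toSpanSingleton_apply, one_smul] at h
  rw [fockLift, ← h, fockBasis]

theorem wordProd_creation_fockBasis {ι : Type*} (α β : FreeMonoid ι) :
    wordProd creation α (fockBasis β) = fockBasis (α * β) := by
  induction α using FreeMonoid.recOn with
  | one => simp [wordProd]
  | of_mul i α hα =>
    rw [wordProd] at hα ⊢
    rw [map_mul, FreeMonoid.lift_eval_of, mul_apply_eq_comp, hα, creation_fockBasis,
      mul_assoc]

theorem gauge_orthonormal (ι : Type*) {z : ℂ} (hz : ‖z‖ = 1) :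
    Orthonormal ℂ (fun α : FreeMonoid ι => z ^ α.length • (fockBasis α : Fock ι)) := by
  refine ⟨fun α => ?_, fun α β hαβ => ?_⟩
  · rw [norm_smul, norm_pow, hz, one_pow, one_mul, (fockBasis_orthonormal ι).1]
  · change inner ℂ _ _ = _
    rw [inner_smul_left, inner_smul_right, (fockBasis_orthonormal ι).2 hαβ,
      mul_zero, mul_zero]

/-- The gauge isometry `e_α ↦ z ^ |α| e_α` of the Fock space, for `|z| = 1`. -/
def gauge (ι : Type*) {z : ℂ} (hz : ‖z‖ = 1) : Fock ι →ₗᵢ[ℂ] Fock ι :=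
  fockLift (gauge_orthonormal ι hz)

theorem gauge_fockBasis {ι : Type*} {z : ℂ} (hz : ‖z‖ = 1) (α : FreeMonoid ι) :
    gauge ι hz (fockBasis α) = z ^ α.length • (fockBasis α : Fock ι) :=
  fockLift_fockBasis _ _

theorem smul_wordProd_comp_gauge {ι : Type*} {z : ℂ} (hz : ‖z‖ = 1) (α : FreeMonoid ι) :
    z ^ α.length • (wordProd creation α ∘L (gauge ι hz).toContinuousLinearMap) =
      (gauge ι hz).toContinuousLinearMap ∘L wordProd creation α := by
  refine fock_ext fun β => ?_
  simp only [smul_apply, ContinuousLinearMap.comp_apply,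
    LinearIsometry.coe_toContinuousLinearMap, gauge_fockBasis, map_smul,
    wordProd_creation_fockBasis, smul_smul, FreeMonoid.length_mul, pow_add]

/-- Concatenation of words of length `k`. -/
def wordsFlatten (ι : Type*) (k : ℕ) : FreeMonoid (Words ι k) →* FreeMonoid ι :=
  FreeMonoid.lift Subtype.val

theorem wordsFlatten_of {ι : Type*} {k : ℕ} (α : Words ι k) :
    wordsFlatten ι k (FreeMonoid.of α) = α := FreeMonoid.lift_eval_of _ _

/-- Words of one fixed length form a code: the first `k` letters determine the first block. For `k =
0` every product would be empty. -/
theorem wordsFlatten_injective (ι : Type*) {k : ℕ} (hk : 1 ≤ k) :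
    Function.Injective (wordsFlatten ι k) := by
  have hne : ∀ (α : Words ι k) (β : FreeMonoid (Words ι k)),
      (wordsFlatten ι k (FreeMonoid.of α * β)).length ≠ 0 := by
    intro α β
    rw [map_mul, wordsFlatten_of, FreeMonoid.length_mul, α.2]
    omega
  intro α
  induction α using FreeMonoid.recOn with
  | one =>
    intro β h
    cases β using FreeMonoid.casesOn with
    | one => rfl
    | of_mul j β => exact absurd (by rw [← h, map_one, FreeMonoid.length_one]) (hne j β)
  | of_mul i α hα =>
    intro β h
    cases β using FreeMonoid.casesOn with
    | one => exact absurd (by rw [h, map_one, FreeMonoid.length_one]) (hne i α)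
    | of_mul j β =>
      rw [map_mul, map_mul, wordsFlatten_of, wordsFlatten_of] at h
      obtain ⟨h1, h2⟩ := List.append_inj (s₁ := (i : FreeMonoid ι).toList)
        (s₂ := (j : FreeMonoid ι).toList) h (i.2.trans j.2.symm)
      rw [hα h2, Subtype.ext (a1 := i) (a2 := j) h1]

/-- The isometry `e_{(α₁, …, αⱼ)} ↦ e_{α₁ ⋯ αⱼ}` from the Fock space over the alphabet of words of
length `k`. -/
def regroup (ι : Type*) {k : ℕ} (hk : 1 ≤ k) : Fock (Words ι k) →ₗᵢ[ℂ] Fock ι :=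
  fockLift ((fockBasis_orthonormal ι).comp _ (wordsFlatten_injective ι hk))

theorem regroup_fockBasis {ι : Type*} {k : ℕ} (hk : 1 ≤ k) (α : FreeMonoid (Words ι k)) :
    regroup ι hk (fockBasis α) = fockBasis (wordsFlatten ι k α) :=
  fockLift_fockBasis _ _

theorem wordProd_comp_regroup {ι : Type*} {k : ℕ} (hk : 1 ≤ k) (α : Words ι k) :
    wordProd creation (α : FreeMonoid ι) ∘L (regroup ι hk).toContinuousLinearMap =
      (regroup ι hk).toContinuousLinearMap ∘L creation α := by
  refine fock_ext fun β => ?_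
  simp only [ContinuousLinearMap.comp_apply, LinearIsometry.coe_toContinuousLinearMap,
    regroup_fockBasis, wordProd_creation_fockBasis, creation_fockBasis, map_mul, wordsFlatten_of]

/-! ### Isometries on the Hilbert space tensor product -/

section Tensor

variable {E F G H : Type*} [NormedAddCommGroup E] [InnerProductSpace ℂ E]
  [NormedAddCommGroup F] [InnerProductSpace ℂ F]
  [NormedAddCommGroup G] [InnerProductSpace ℂ G]
  [NormedAddCommGroup H] [InnerProductSpace ℂ H]

theorem hTensor_ext {f g : HTensor E H →L[ℂ] G}
    (h : ∀ x y, f ((x ⊗ₜ[ℂ] y : E ⊗[ℂ] H) : HTensor E H) =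
      g ((x ⊗ₜ[ℂ] y : E ⊗[ℂ] H) : HTensor E H)) : f = g := by
  ext x
  induction x using UniformSpace.Completion.induction_on with
  | hp => exact isClosed_eq f.continuous g.continuous
  | ih x =>
    induction x using TensorProduct.induction_on with
    | zero => rw [UniformSpace.Completion.coe_zero, map_zero, map_zero]
    | tmul x y => exact h x y
    | add x y hx hy => rw [UniformSpace.Completion.coe_add, map_add, map_add, hx, hy]

theorem opTensor_sub (T : E →L[ℂ] E) (A B : H →L[ℂ] H) :
    opTensor T (A - B) = opTensor T A - opTensor T B := by
  refine hTensor_ext fun x y => ?_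
  rw [sub_apply, opTensor_tmul, opTensor_tmul, opTensor_tmul,
    sub_apply, TensorProduct.tmul_sub, UniformSpace.Completion.coe_sub]

theorem norm_opTensor_apply_le (T : E →L[ℂ] E) (A : H →L[ℂ] H) (x : HTensor E H) :
    ‖opTensor T A x‖ ≤ ‖T‖ * ‖A‖ * ‖x‖ := by
  induction x using UniformSpace.Completion.induction_on with
  | hp => exact isClosed_le (by fun_prop) (by fun_prop)
  | ih x =>
    rw [opTensor, ContinuousLinearMap.completion_apply_coe, UniformSpace.Completion.norm_coe,
      UniformSpace.Completion.norm_coe]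
    exact (TensorProduct.mapL T A).le_of_opNorm_le (TensorProduct.norm_mapL_le T A) x

/-- The operator `W ⊗ I` for an isometry `W`. -/
def isometryTensor (H : Type*) [NormedAddCommGroup H] [InnerProductSpace ℂ H] (W : E →ₗᵢ[ℂ] F) :
    HTensor E H →L[ℂ] HTensor F H :=
  (W.rTensor H).toContinuousLinearMap.completion

theorem isometryTensor_tmul (W : E →ₗᵢ[ℂ] F) (x : E) (y : H) :
    isometryTensor H W ((x ⊗ₜ[ℂ] y : E ⊗[ℂ] H) : HTensor E H) =
      ((W x ⊗ₜ[ℂ] y : F ⊗[ℂ] H) : HTensor F H) := by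
  simp [isometryTensor]

theorem inner_isometryTensor (W : E →ₗᵢ[ℂ] F) (x y : HTensor E H) :
    inner ℂ (isometryTensor H W x) (isometryTensor H W y) = inner ℂ x y := by
  induction x, y using UniformSpace.Completion.induction_on₂ with
  | hp => exact isClosed_eq (by fun_prop) (by fun_prop)
  | ih x y =>
    rw [isometryTensor, ContinuousLinearMap.completion_apply_coe,
      ContinuousLinearMap.completion_apply_coe, UniformSpace.Completion.inner_coe,
      UniformSpace.Completion.inner_coe, LinearIsometry.coe_toContinuousLinearMap,
      LinearIsometry.inner_map_map]

/-- The scalar lets one statement serve both the gauge isometry (`c = z ^ |α|`) and regrouping (`c =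
1`). -/
theorem smul_opTensor_isometryTensor {W : E →ₗᵢ[ℂ] F} {T : F →L[ℂ] F} {T' : E →L[ℂ] E} {c : ℂ}
    (h : c • (T ∘L W.toContinuousLinearMap) = W.toContinuousLinearMap ∘L T') (A : H →L[ℂ] H)
    (x : HTensor E H) :
    c • opTensor T A (isometryTensor H W x) = isometryTensor H W (opTensor T' A x) := by
  suffices c • (opTensor T A ∘L isometryTensor H W) = isometryTensor H W ∘L opTensor T' A from
    congrArg (fun f => f x) this
  refine hTensor_ext fun x y => ?_
  have hx := congrArg (fun f => f x) h
  simp only [smul_apply, ContinuousLinearMap.comp_apply,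
    LinearIsometry.coe_toContinuousLinearMap] at hx
  simp only [smul_apply, ContinuousLinearMap.comp_apply, isometryTensor_tmul,
    opTensor_tmul, ← hx]
  rw [← UniformSpace.Completion.coe_smul, TensorProduct.smul_tmul']

theorem mul_inner_opTensor_isometryTensor {W : E →ₗᵢ[ℂ] F} {T : F →L[ℂ] F} {T' : E →L[ℂ] E} {c : ℂ}
    (h : c • (T ∘L W.toContinuousLinearMap) = W.toContinuousLinearMap ∘L T') (A : H →L[ℂ] H)
    (x : HTensor E H) :
    c * inner ℂ (isometryTensor H W x) (opTensor T A (isometryTensor H W x)) =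
      inner ℂ x (opTensor T' A x) := by
  rw [← inner_smul_right, smul_opTensor_isometryTensor h, inner_isometryTensor]

end Tensor

/-! ### Positivity and numerical radii -/

theorem analyticPoly_sub {n : ℕ} {H : Type*} [NormedAddCommGroup H] [InnerProductSpace ℂ H]
    (m : ℕ) (A B : FreeMonoid (Fin n) → H →L[ℂ] H) :
    analyticPoly m (A - B) = analyticPoly m A - analyticPoly m B := by
  simp only [analyticPoly, Pi.sub_apply, opTensor_sub, Finset.sum_sub_distrib, smul_sub]
  abel

theorem re_inner_analyticPoly_nonneg {n : ℕ} {H : Type*} [NormedAddCommGroup H]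
    [InnerProductSpace ℂ H] {m : ℕ} {A B : FreeMonoid (Fin n) → H →L[ℂ] H}
    (h : harmonicPoly m A ≤ harmonicPoly m B) (x : HTensor (Fock (Fin n)) H) :
    0 ≤ (inner ℂ x (analyticPoly m (B - A) x)).re := by
  have h1 := ((ContinuousLinearMap.le_def _ _).1 h).re_inner_nonneg_right x
  have h2 : harmonicPoly m B - harmonicPoly m A = (1 / 2 : ℂ) • (analyticPoly m (B - A) +
      ContinuousLinearMap.adjoint (analyticPoly m (B - A))) := by
    rw [harmonicPoly, harmonicPoly, analyticPoly_sub, map_sub, ← smul_sub]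
    congr 1
    abel
  rw [h2, smul_apply, add_apply, inner_smul_right,
    inner_add_right, ContinuousLinearMap.adjoint_inner_right,
    ← inner_conj_symm (analyticPoly m (B - A) x) x] at h1
  have h3 : 0 ≤ (1 / 2 : ℝ) * (2 * (inner ℂ x (analyticPoly m (B - A) x)).re) := by
    convert h1 using 1
    rw [show (1 / 2 : ℂ) = ((1 / 2 : ℝ) : ℂ) by norm_num]
    change _ = (_ : ℂ).re
    rw [Complex.re_ofReal_mul, Complex.add_re, Complex.conj_re, two_mul]
  linarith

/-- Nonnegativity of `c` covers the zero space, where the supremum is over the empty set and equals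
`0`. -/
theorem numericalRadius_le {E : Type*} [NormedAddCommGroup E] [InnerProductSpace ℂ E]
    {T : E →L[ℂ] E} {c : ℝ} (hc : 0 ≤ c) (h : ∀ x, ‖x‖ = 1 → ‖inner ℂ (T x) x‖ ≤ c) :
    numericalRadius T ≤ c :=
  Real.sSup_le (by rintro _ ⟨x, hx, rfl⟩; exact h x hx) hc

theorem norm_inner_le_numericalRadius {E : Type*} [NormedAddCommGroup E] [InnerProductSpace ℂ E]
    (T : E →L[ℂ] E) {x : E} (hx : ‖x‖ = 1) : ‖inner ℂ (T x) x‖ ≤ numericalRadius T :=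
  le_csSup (numericalRadius_bddAbove T) ⟨x, hx, rfl⟩

theorem numericalRadius_nonneg {E : Type*} [NormedAddCommGroup E] [InnerProductSpace ℂ E]
    (T : E →L[ℂ] E) : 0 ≤ numericalRadius T :=
  Real.sSup_nonneg (by rintro _ ⟨x, _, rfl⟩; exact norm_nonneg _)

theorem numericalRadius_sub_le {E : Type*} [NormedAddCommGroup E] [InnerProductSpace ℂ E]
    (S T : E →L[ℂ] E) : numericalRadius (S - T) ≤ numericalRadius S + numericalRadius T := by
  refine numericalRadius_le (add_nonneg (numericalRadius_nonneg S) (numericalRadius_nonneg T))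
    fun x hx => ?_
  rw [sub_apply, inner_sub_left]
  exact (norm_sub_le _ _).trans
    (add_le_add (norm_inner_le_numericalRadius S hx) (norm_inner_le_numericalRadius T hx))

section Hilbert

variable {H : Type*} [NormedAddCommGroup H] [InnerProductSpace ℂ H] [CompleteSpace H]

theorem jointNumericalRadius_sub_le {ι : Type*} [Fintype ι] (X Y : ι → H →L[ℂ] H) :
    jointNumericalRadius (fun i => X i - Y i) ≤ jointNumericalRadius X + jointNumericalRadius Y := by
  simp only [jointNumericalRadius, map_sub, opTensor_sub, Finset.sum_sub_distrib]
  exact numericalRadius_sub_le _ _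

/-! ### The two inequalities -/

theorem jointNumericalRadius_le_of_harmonicPoly_le {n m : ℕ}
    {A B : FreeMonoid (Fin n) → H →L[ℂ] H} (h : harmonicPoly m A ≤ harmonicPoly m B)
    {k : ℕ} (hk : 1 ≤ k) (hkm : k ≤ m - 1) :
    jointNumericalRadius (fun α : Words (Fin n) k =>
        ContinuousLinearMap.adjoint (B α) - ContinuousLinearMap.adjoint (A α)) ≤
      ‖B 1 - A 1‖ * fejerConst m k := by
  refine numericalRadius_le (mul_nonneg (norm_nonneg _) (fejerConst_nonneg m k)) fun x hx => ?_
  set C := B - A with hC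
  set y := isometryTensor H (regroup (Fin n) hk) x with hy
  let f : ℕ → ℂ := fun p => ∑ α : Words (Fin n) p,
    inner ℂ y (opTensor (wordProd creation (α : FreeMonoid (Fin n))) (C α) y)
  let a : ℝ := (inner ℂ y (opTensor (ContinuousLinearMap.id ℂ (Fock (Fin n))) (C 1) y)).re / 2
  have hpos : ∀ z : ℂ, ‖z‖ = 1 → 0 ≤ a + (∑ p ∈ Finset.Icc 1 (m - 1), z ^ p * f p).re := by
    intro z hz
    -- The gauge isometry intertwines with `z ^ |α|` on the left side, so the conjugate parameter is
    -- what produces `z ^ p`.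
    have hz' : ‖starRingEnd ℂ z‖ = 1 := by rw [RCLike.norm_conj, hz]
    have hzz : z * starRingEnd ℂ z = 1 := by
      rw [Complex.mul_conj, Complex.normSq_eq_norm_sq, hz]; norm_num
    have h0 := mul_inner_opTensor_isometryTensor (W := gauge (Fin n) hz') (c := 1)
      (T := ContinuousLinearMap.id ℂ (Fock (Fin n)))
      (T' := ContinuousLinearMap.id ℂ (Fock (Fin n))) (one_smul _ _) (C 1) y
    have hα : ∀ p, ∀ α : Words (Fin n) p, inner ℂ (isometryTensor H (gauge (Fin n) hz') y)
        (opTensor (wordProd creation (α : FreeMonoid (Fin n))) (C α)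
          (isometryTensor H (gauge (Fin n) hz') y)) =
        z ^ p * inner ℂ y (opTensor (wordProd creation (α : FreeMonoid (Fin n))) (C α) y) := by
      intro p α
      rw [← mul_inner_opTensor_isometryTensor (smul_wordProd_comp_gauge hz' (α : FreeMonoid (Fin n)))
        (C α) y,
        α.2, ← mul_assoc, ← mul_pow, hzz, one_pow, one_mul]
    have hre := re_inner_analyticPoly_nonneg h (isometryTensor H (gauge (Fin n) hz') y)
    rw [analyticPoly] at hre
    simp only [add_apply, smul_apply,
      sum_apply, inner_add_right, inner_smul_right, inner_sum,
      ← hC, hα, ← Finset.mul_sum] at hre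
    rw [one_mul] at h0
    rw [h0, Complex.add_re] at hre
    refine hre.trans_eq (congrArg₂ (· + ·) ?_ rfl)
    rw [show (1 / 2 : ℂ) = ((1 / 2 : ℝ) : ℂ) by norm_num, Complex.re_ofReal_mul]
    simp only [a]
    ring
  have hfk := norm_coeff_le_of_trigPoly_nonneg hk hkm a f hpos
  have hyx : ‖y‖ = 1 := by
    rw [@norm_eq_sqrt_re_inner ℂ, hy, inner_isometryTensor, ← @norm_eq_sqrt_re_inner ℂ, hx]
  have ha : 2 * a ≤ ‖B 1 - A 1‖ := by
    have h1 := norm_inner_le_norm (𝕜 := ℂ) y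
      (opTensor (ContinuousLinearMap.id ℂ (Fock (Fin n))) (C 1) y)
    have h2 := norm_opTensor_apply_le (ContinuousLinearMap.id ℂ (Fock (Fin n))) (C 1) y
    have h3 : ‖ContinuousLinearMap.id ℂ (Fock (Fin n))‖ * ‖C 1‖ ≤ 1 * ‖C 1‖ :=
      mul_le_mul_of_nonneg_right ContinuousLinearMap.norm_id_le (norm_nonneg _)
    rw [hyx, one_mul] at h1
    rw [hyx, mul_one] at h2
    have h4 : 2 * a = (inner ℂ y
        (opTensor (ContinuousLinearMap.id ℂ (Fock (Fin n))) (C 1) y)).re := by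
      simp only [a]; ring
    rw [h4]
    exact (Complex.re_le_norm _).trans (h1.trans (h2.trans (h3.trans_eq (one_mul _))))
  -- The adjoints in the joint numerical radius cancel; the conjugate appears because `f k` has the
  -- operator in the second slot.
  have hfx : inner ℂ ((∑ α : Words (Fin n) k, opTensor (creation α) (ContinuousLinearMap.adjoint
      (ContinuousLinearMap.adjoint (B α) - ContinuousLinearMap.adjoint (A α)))) x) x =
      starRingEnd ℂ (f k) := by
    rw [← inner_conj_symm, sum_apply, inner_sum]
    congr 1
    refine Finset.sum_congr rfl fun α _ => ?_
    rw [map_sub, ContinuousLinearMap.adjoint_adjoint, ContinuousLinearMap.adjoint_adjoint, hy,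
      ← mul_inner_opTensor_isometryTensor
        ((one_smul ℂ _).trans (wordProd_comp_regroup hk α)) (B α - A α) x, one_mul]
    rfl
  rw [hfx, RCLike.norm_conj]
  exact hfk.trans (mul_le_mul_of_nonneg_right ha (fejerConst_nonneg m k))

theorem sum_jointNumericalRadius_le_of_harmonicPoly_le {n m : ℕ}
    {A B : FreeMonoid (Fin n) → H →L[ℂ] H} (h : harmonicPoly m A ≤ harmonicPoly m B)
    {t r : ℝ} (ht : IsBohrRadius m t) (hr : 0 ≤ r) (hrt : r ≤ t) :
    ∑ k ∈ Finset.Icc 1 (m - 1), r ^ k *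
        jointNumericalRadius (fun α : Words (Fin n) k => ContinuousLinearMap.adjoint (A α)) ≤
      1 / 2 * ‖B 1 - A 1‖ + ∑ k ∈ Finset.Icc 1 (m - 1), r ^ k *
        jointNumericalRadius (fun α : Words (Fin n) k => ContinuousLinearMap.adjoint (B α)) := by
  have hterm : ∀ k ∈ Finset.Icc 1 (m - 1), r ^ k *
        jointNumericalRadius (fun α : Words (Fin n) k => ContinuousLinearMap.adjoint (A α)) ≤
      ‖B 1 - A 1‖ * (t ^ k * fejerConst m k) + r ^ k *
        jointNumericalRadius (fun α : Words (Fin n) k => ContinuousLinearMap.adjoint (B α)) := by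
    intro k hk
    obtain ⟨hk1, hkm⟩ := Finset.mem_Icc.1 hk
    -- Triangle inequality for `A = B - (B - A)`.
    have h1 := jointNumericalRadius_sub_le
      (fun α : Words (Fin n) k => ContinuousLinearMap.adjoint (B α))
      (fun α : Words (Fin n) k => ContinuousLinearMap.adjoint (B α) -
        ContinuousLinearMap.adjoint (A α))
    simp only [sub_sub_cancel] at h1
    have h2 := jointNumericalRadius_le_of_harmonicPoly_le h hk1 hkm
    have h3 : r ^ k * (‖B 1 - A 1‖ * fejerConst m k) ≤ t ^ k * (‖B 1 - A 1‖ * fejerConst m k) :=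
      mul_le_mul_of_nonneg_right (pow_le_pow_left₀ hr hrt k)
        (mul_nonneg (norm_nonneg _) (fejerConst_nonneg m k))
    have h4 := mul_le_mul_of_nonneg_left (h1.trans (add_le_add_right h2 _)) (pow_nonneg hr k)
    linarith
  refine (Finset.sum_le_sum hterm).trans_eq ?_
  rw [Finset.sum_add_distrib, ← Finset.mul_sum, ht.2, mul_comm]

end Hilbert

end NCHarmonic

end

theorem theorem3p2 {H : Type*} [NormedAddCommGroup H] [InnerProductSpace ℂ H] [CompleteSpace H]
    (n : ℕ) (hn : 1 ≤ n) (m : ℕ) (hm : 2 ≤ m) :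
    (∃! t : ℝ, NCHarmonic.IsBohrRadius m t) ∧
    ∀ A B : FreeMonoid (Fin n) → H →L[ℂ] H,
      IsSelfAdjoint (A 1) → IsSelfAdjoint (B 1) →
      NCHarmonic.harmonicPoly m A ≤ NCHarmonic.harmonicPoly m B →
      (∀ k : ℕ, 1 ≤ k → k ≤ m - 1 →
        NCHarmonic.jointNumericalRadius
            (fun α : NCHarmonic.Words (Fin n) k =>
              ContinuousLinearMap.adjoint (B α) - ContinuousLinearMap.adjoint (A α))
          ≤ ‖B 1 - A 1‖ * NCHarmonic.fejerConst m k) ∧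
      (∀ t : ℝ, NCHarmonic.IsBohrRadius m t → ∀ r : ℝ, 0 ≤ r → r ≤ t →
        ∑ k ∈ Finset.Icc 1 (m - 1), r ^ k *
            NCHarmonic.jointNumericalRadius
              (fun α : NCHarmonic.Words (Fin n) k => ContinuousLinearMap.adjoint (A α))
          ≤ 1 / 2 * ‖B 1 - A 1‖ +
            ∑ k ∈ Finset.Icc 1 (m - 1), r ^ k *
              NCHarmonic.jointNumericalRadius
                (fun α : NCHarmonic.Words (Fin n) k => ContinuousLinearMap.adjoint (B α))) := by
  refine ⟨NCHarmonic.existsUnique_isBohrRadius hm, fun A B _ _ h => ⟨fun k hk hkm => ?_,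
    fun t ht r hr hrt => ?_⟩⟩
  · exact NCHarmonic.jointNumericalRadius_le_of_harmonicPoly_le h hk hkm
  · exact NCHarmonic.sum_jointNumericalRadius_le_of_harmonicPoly_le h ht hr hrt
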